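/- Let $q$ be an indeterminate and work over the field $\mathbb{C}(q)$. **The algebra $A_q(B_n)$.** Let $N=2n+1$, $i'=N+1-i$ and $(\varrho_1,\ldots,\varrho_N)=(2n-1,\ldots,3,1,0,-1,-3,\ldots,-2n+1)$. Put $C_{ij}=\delta_{i,N+1-j}\,q^{\varrho_j}$. Let $R(x)$ be Jimbo's quantum $R$ matrix for the vector representation of $U_q(B_n^{(1)})$ with Jimbo's parameter $k$, and define $R_{ij,ml}$ by $$\sum_{i,j,m,l}R_{ij,ml}\,E_{im}\otimes E_{jl}=q^2\lim_{x\to\infty}x^{-2}R(x)\big|_{k=q^{-2}};$$ explicitly, with $E_{ij}$ the $N\times N$ matrix units, the right-hand side is $$\sum_{i\ne i'}\left(q^2E_{ii}\otimes E_{ii}+q^{-2}E_{ii}\otimes E_{i'i'}\right)+E_{n+1,n+1}\otimes E_{n+1,n+1}+\sum_{i\neq j,j'}E_{ii}\otimes E_{jj}+(q^2-q^{-2})\sum_{i>j}\left(E_{ij}\otimes E_{ji}-q^{\varrho_i-\varrho_j}E_{ij}\otimes E_{i'j'}\right).$$ $A_q(B_n)$ is the associative unital $\mathbb{C}(q)$-algebra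 generated by $t_{ij}$ $(1\le i,j\le N)$ with the relations (repeated indices are summed over $1,\ldots,N$) $$R_{ij,mp}\,t_{mk}t_{pl}=t_{jp}t_{im}\,R_{mp,kl},\qquad C_{jk}C_{lm}\,t_{ij}t_{lk}=C_{ij}C_{kl}\,t_{kj}t_{lm}=\delta_{im}.$$ **The $q$-oscillator algebra.** $\mathrm{Osc}_q$ is the unital $\mathbb{C}(q)$-algebra generated by $\mathbf a^+,\mathbf a^-,\mathbf k$ with the relations $$\mathbf k\mathbf a^+=q\,\mathbf a^+\mathbf k,\quad \mathbf k\mathbf a^-=q^{-1}\mathbf a^-\mathbf k,\quad \mathbf a^-\mathbf a^+=\mathbf 1-q^2\mathbf k^2,\quad \mathbf a^+\mathbf a^-=\mathbf 1-\mathbf k^2.$$ It acts on the Fock space $\mathcal F_q=\bigoplus_{m\ge0}\mathbb{C}(q)|m\rangle$ by $\mathbf k|m\rangle=q^m|m\rangle$, $\mathbf a^+|m\rangle=|m+1\rangle$, $\mathbf a^-|m\rangle=(1-q^{2m})|m-1\rangle$. Write $\mathbf A^+,\mathbf A^-,\mathbf K$ for the generators of $\mathrm{Osc}_{q^2}$ (the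 same definitions with $q$ replaced by $q^2$), which acts on $\mathcal F_{q^2}$. **The maps.** Put $(q_1,q_2,q_3)=(q^2,q^2,q)$ and $r=1+q^2$. Let $\alpha_i,\beta_i,\mu_i,\nu_i,\kappa_i,\sigma_i$ $(i=1,2)$ and $\alpha_3,\mu_3,\kappa_{31},\kappa_{32}$ be nonzero elements of $\mathbb{C}(q)$ such that $\alpha_i\beta_i=-q^2\mu_i\nu_i$ and $\sigma_i=\pm1$ for $i=1,2$. Consider the assignments $(t_{ij})_{1\le i,j\le 7}\mapsto\pi_a\bigl((t_{ij})\bigr)$, $a=1,2,3$, given by the following block diagonal $7\times7$ matrices over $\mathrm{Osc}_{q_a}$: $$\pi_1:\ \mathrm{diag}\left(\begin{pmatrix}\mu_1\mathbf A^-&\alpha_1\mathbf K\\ \beta_1\mathbf K&\nu_1\mathbf A^+\end{pmatrix},\ \kappa_1\mathbf 1,\ \sigma_1\mathbf 1,\ \kappa_1^{-1}\mathbf 1,\ \begin{pmatrix}\nu_1^{-1}\mathbf A^-&q^2\beta_1^{-1}\mathbf K\\ q^2\alpha_1^{-1}\mathbf K&\mu_1^{-1}\mathbf A^+\end{pmatrix}\right),$$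 $$\pi_2:\ \mathrm{diag}\left(\kappa_2\mathbf 1,\ \begin{pmatrix}\mu_2\mathbf A^-&\alpha_2\mathbf K\\ \beta_2\mathbf K&\nu_2\mathbf A^+\end{pmatrix},\ \sigma_2\mathbf 1,\ \begin{pmatrix}\nu_2^{-1}\mathbf A^-&q^2\beta_2^{-1}\mathbf K\\ q^2\alpha_2^{-1}\mathbf K&\mu_2^{-1}\mathbf A^+\end{pmatrix},\ \kappa_2^{-1}\mathbf 1\right),$$ $$\pi_3:\ \mathrm{diag}\left(\kappa_{31}\mathbf 1,\ \kappa_{32}\mathbf 1,\ \begin{pmatrix}\mu_3(\mathbf a^-)^2&\alpha_3\mathbf k\mathbf a^-&-(r\mu_3)^{-1}\alpha_3^2\mathbf k^2\\ -r\alpha_3^{-1}\mu_3\mathbf a^-\mathbf k&\mathbf a^-\mathbf a^+-\mathbf k^2&-(q\mu_3)^{-1}\alpha_3\mathbf k\mathbf a^+\\ -r(q\alpha_3^{-1})^2\mu_3\mathbf k^2&r\alpha_3^{-1}\mathbf k\mathbf a^+&\mu_3^{-1}(\mathbf a^+)^2\end{pmatrix},\ \kappa_{32}^{-1}\mathbf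 1,\ \kappa_{31}^{-1}\mathbf 1\right).$$ **Proposition.** For each $a=1,2,3$ the assignment $\pi_a$ on the generators extends (uniquely) to a homomorphism of unital $\mathbb{C}(q)$-algebras $\pi_a:A_q(B_3)\to\mathrm{Osc}_{q_a}$, and the resulting representation of $A_q(B_3)$ on the Fock space $\mathcal F_{q_a}$ is irreducible. -/

import Mathlib

open scoped Kronecker

noncomputable section

namespace QFun

variable {K : Type*} [Field K]

/-! ### Structure constants of type `B_n` (indices `0, …, 2n`, so `i.rev` is the index `i'`) -/

/-- `(ϱ_1, …, ϱ_N) = (2n-1, …, 3, 1, 0, -1, -3, …, -2n+1)`, with zero-based indices. -/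
def rho (n : ℕ) (i : Fin (2 * n + 1)) : ℤ :=
  if (i : ℕ) < n then 2 * ((n : ℤ) - i) - 1
  else if (i : ℕ) = n then 0
  else 2 * ((n : ℤ) - i) + 1

/-- `C_{ij} = δ_{i, N+1-j} q^{ϱ_j}`. -/
def cMatrix (q : K) (n : ℕ) : Matrix (Fin (2 * n + 1)) (Fin (2 * n + 1)) K :=
  fun i j => if i = j.rev then q ^ rho n j else 0

/-- `2 ᾱ` in Jimbo's notation, where for one-based `α`: `ᾱ = α + 1/2` for `α ≤ n`,
`ᾱ = n + 1` for `α = n + 1` and `ᾱ = α - 1/2` for `α ≥ n + 2`. -/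
def twoBar (n : ℕ) (i : Fin (2 * n + 1)) : ℤ :=
  if (i : ℕ) < n then 2 * ((i : ℤ) + 1) + 1
  else if (i : ℕ) = n then 2 * ((n : ℤ) + 1)
  else 2 * ((i : ℤ) + 1) - 1

open Polynomial in
/-- The coefficients `a_{αβ}(x)` of Jimbo's `R` matrix for the vector representation of
`U_q(B_n^{(1)})`. Here `h` is a square root of Jimbo's `k` (half-integral powers of `k` occur),
and `ξ = k^{2n-1}`; `ε_α = 1` in type `B`. -/
def jimboCoeff (h : K) (n : ℕ) (a b : Fin (2 * n + 1)) : K[X] :=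
  let k : K := h ^ 2
  let ξ : K := k ^ (2 * (n : ℤ) - 1)
  let δ : K[X] := if a = b.rev then 1 else 0
  if a = b then
    if a = a.rev then C k * (X - C ξ) * (X - 1) + C ((ξ - 1) * (k ^ 2 - 1)) * X
    else (C (k ^ 2) * X - C ξ) * (X - 1)
  else if a < b then
    C (k ^ 2 - 1) * (C (ξ * h ^ (twoBar n a - twoBar n b)) * (X - 1) - δ * (X - C ξ))
  else
    C (k ^ 2 - 1) * X * (C (h ^ (twoBar n a - twoBar n b)) * (X - 1) - δ * (X - C ξ))

/-- The matrix unit `E_{ab}`. -/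
def E (A : Type*) [Zero A] [One A] {N : ℕ} (a b : Fin N) : Matrix (Fin N) (Fin N) A :=
  Matrix.single a b 1

open Polynomial in
/-- Jimbo's quantum `R` matrix `R(x)` for the vector representation of `U_q(B_n^{(1)})`, with
entries polynomials in the spectral parameter `x`, and `k = h ^ 2`. -/
def jimboR (h : K) (n : ℕ) :
    Matrix (Fin (2 * n + 1) × Fin (2 * n + 1)) (Fin (2 * n + 1) × Fin (2 * n + 1)) K[X] :=
  let k : K := h ^ 2
  let ξ : K := k ^ (2 * (n : ℤ) - 1)
  ∑ a, ∑ b,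
    ((if a = b ∧ a ≠ a.rev then (X - C (k ^ 2)) * (X - C ξ) else 0) • (E K[X] a a ⊗ₖ E K[X] b b)
    + (if a ≠ b ∧ a ≠ b.rev then C k * (X - 1) * (X - C ξ) else 0) • (E K[X] a a ⊗ₖ E K[X] b b)
    + (if a < b ∧ a ≠ b.rev then - C (k ^ 2 - 1) * (X - C ξ) else 0) • (E K[X] a b ⊗ₖ E K[X] b a)
    + (if b < a ∧ a ≠ b.rev then - C (k ^ 2 - 1) * (X - C ξ) * X else 0) •
        (E K[X] a b ⊗ₖ E K[X] b a)
    + jimboCoeff h n a b • (E K[X] a b ⊗ₖ E K[X] a.rev b.rev))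

/-- The constant `R` matrix `R = q² lim_{x → ∞} x⁻² R(x)` at `k = q⁻²` (so `k^{1/2} = q⁻¹`).
The entries of `R(x)` are polynomials of degree at most two in `x` (see `natDegree_jimboR_le`), so
the limit is the coefficient of `x²`. The entry at `((i, j), (m, l))` is `R_{ij,ml}`, the
coefficient of `E_{im} ⊗ E_{jl}`. -/
def rMatrix (q : K) (n : ℕ) :
    Matrix (Fin (2 * n + 1) × Fin (2 * n + 1)) (Fin (2 * n + 1) × Fin (2 * n + 1)) K :=
  q ^ 2 • (jimboR q⁻¹ n).map (fun p => p.coeff 2)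

open Polynomial in
theorem natDegree_jimboCoeff_le (h : K) (n : ℕ) (a b : Fin (2 * n + 1)) :
    (jimboCoeff h n a b).natDegree ≤ 2 := by
  unfold jimboCoeff
  dsimp only
  split_ifs <;> first
    | (simp only [one_mul]; compute_degree!)
    | (simp only [zero_mul, sub_zero]; compute_degree!)
    | compute_degree!

open Polynomial in
/-- The entries of `R(x)` have degree at most two in `x`. -/
theorem natDegree_jimboR_le (h : K) (n : ℕ) (s t : Fin (2 * n + 1) × Fin (2 * n + 1)) :
    (jimboR h n s t).natDegree ≤ 2 := by
  have key : ∀ (p : K[X]) (a b c d : Fin (2 * n + 1)), p.natDegree ≤ 2 →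
      ((p • (E K[X] a b ⊗ₖ E K[X] c d)) s t).natDegree ≤ 2 := by
    intro p a b c d hp
    simp only [E, Matrix.smul_apply, Matrix.kroneckerMap_apply, Matrix.single_apply, smul_eq_mul]
    split_ifs <;> simp [hp]
  unfold jimboR
  simp only [Matrix.sum_apply, Matrix.add_apply]
  refine natDegree_sum_le_of_forall_le _ _ fun a _ =>
    natDegree_sum_le_of_forall_le _ _ fun b _ => ?_
  refine natDegree_add_le_of_degree_le (natDegree_add_le_of_degree_le
    (natDegree_add_le_of_degree_le (natDegree_add_le_of_degree_le (key _ _ _ _ _ ?_)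
      (key _ _ _ _ _ ?_)) (key _ _ _ _ _ ?_)) (key _ _ _ _ _ ?_))
    (key _ _ _ _ _ (natDegree_jimboCoeff_le h n a b))
  all_goals split_ifs <;> compute_degree!

theorem twoBar_eq (n : ℕ) (i : Fin (2 * n + 1)) : twoBar n i = 2 * n + 2 - rho n i := by
  unfold twoBar rho
  split_ifs <;> grind

open Polynomial in
/-- The leading coefficient of `a_{αβ}(x)`, times `q²`, at `k = q⁻²`. -/
theorem jimboCoeff_coeff_two (q : K) (hq : q ≠ 0) (n : ℕ) (a b : Fin (2 * n + 1)) :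
    q ^ 2 * (jimboCoeff q⁻¹ n a b).coeff 2 =
      if a = b then (if a = a.rev then 1 else (q ^ 2)⁻¹)
      else if b < a then
        (q ^ 2 - (q ^ 2)⁻¹) * ((if a = b.rev then 1 else 0) - q ^ (rho n a - rho n b))
      else 0 := by
  have hc : ∀ c d e f : K, ((C c * X + C d) * (C e * X + C f) : K[X]).coeff 2 = c * e := by
    intro c d e f
    have h : ((C c * X + C d) * (C e * X + C f) : K[X]) =
        C (c * e) * X ^ 2 + C (c * f + d * e) * X + C (d * f) := by
      simp only [C_mul, C_add]; ring
    rw [h]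
    simp only [coeff_add, coeff_C_mul, coeff_X_pow, coeff_X, coeff_C]
    norm_num
  have hl : ∀ c d : K, (C c * X + C d : K[X]).coeff 2 = 0 := by
    intro c d
    simp only [coeff_add, coeff_C_mul, coeff_X_pow, coeff_X, coeff_C]
    norm_num
  have hpow : (q⁻¹ : K) ^ (twoBar n a - twoBar n b) = q ^ (rho n a - rho n b) := by
    rw [inv_zpow', twoBar_eq, twoBar_eq]
    congr 1
    ring
  unfold jimboCoeff
  simp only [hpow]
  generalize (((q⁻¹ : K) ^ 2) ^ (2 * (n : ℤ) - 1)) = ξ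
  generalize q ^ (rho n a - rho n b) = w
  by_cases hab : a = b
  · simp only [hab, if_true]
    split_ifs
    · have h : (C ((q⁻¹ : K) ^ 2) * (X - C ξ) * (X - 1)
          + C ((ξ - 1) * (((q⁻¹ : K) ^ 2) ^ 2 - 1)) * X : K[X]) =
          (C ((q⁻¹ : K) ^ 2) * X + C (-((q⁻¹ : K) ^ 2 * ξ))) * (C 1 * X + C (-1))
          + (C ((ξ - 1) * (((q⁻¹ : K) ^ 2) ^ 2 - 1)) * X + C 0) := by
        simp only [C_mul, C_neg, C_1, C_0]; ring
      rw [h, coeff_add, hc, hl]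
      field_simp
      simp
    · have h : ((C (((q⁻¹ : K) ^ 2) ^ 2) * X - C ξ) * (X - 1) : K[X]) =
          (C (((q⁻¹ : K) ^ 2) ^ 2) * X + C (-ξ)) * (C 1 * X + C (-1)) := by
        simp only [C_neg, C_1]; ring
      rw [h, hc]
      field_simp
  · simp only [hab, if_false]
    obtain ⟨d, hd⟩ : ∃ d : K, d = if a = b.rev then 1 else 0 := ⟨_, rfl⟩
    have hd' : (if a = b.rev then 1 else 0 : K[X]) = C d := by
      rw [hd]; split_ifs <;> simp
    rw [hd', ← hd]
    rcases lt_or_gt_of_ne hab with hlt | hgt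
    · rw [if_pos hlt, if_neg hlt.not_gt]
      have h : (C (((q⁻¹ : K) ^ 2) ^ 2 - 1) * (C (ξ * w) * (X - 1) - C d * (X - C ξ)) : K[X]) =
          C ((((q⁻¹ : K) ^ 2) ^ 2 - 1) * (ξ * w - d)) * X
          + C ((((q⁻¹ : K) ^ 2) ^ 2 - 1) * (d * ξ - ξ * w)) := by
        simp only [C_mul, C_sub]; ring
      rw [h, hl, mul_zero]
    · rw [if_neg hgt.not_gt, if_pos hgt]
      have h : (C (((q⁻¹ : K) ^ 2) ^ 2 - 1) * X * (C w * (X - 1) - C d * (X - C ξ)) : K[X]) =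
          (C (((q⁻¹ : K) ^ 2) ^ 2 - 1) * X + C 0) * (C (w - d) * X + C (d * ξ - w)) := by
        simp only [C_mul, C_sub, C_0]; ring
      rw [h, hc]
      field_simp
      ring

open Polynomial in
theorem map_coeff_smul_single {N : ℕ} (p : K[X]) (a b c d : Fin N) :
    (p • (E K[X] a b ⊗ₖ E K[X] c d)).map (fun f => f.coeff 2) =
      p.coeff 2 • (E K a b ⊗ₖ E K c d) := by
  ext s u
  simp only [E, Matrix.map_apply, Matrix.smul_apply, Matrix.kroneckerMap_apply,
    Matrix.single_apply, smul_eq_mul]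
  split_ifs <;> simp

open Polynomial in
/-- The explicit form of the constant `R` matrix. -/
theorem rMatrix_eq (q : K) (hq : q ≠ 0) (n : ℕ) :
    rMatrix q n =
      ∑ a : Fin (2 * n + 1), (if a = a.rev then (1 : K) else (q ^ 2)⁻¹) •
          (E K a a ⊗ₖ E K a.rev a.rev)
      + ∑ a : Fin (2 * n + 1), ∑ b : Fin (2 * n + 1),
        ((if a = b ∧ a ≠ a.rev then q ^ 2 else 0) • (E K a a ⊗ₖ E K b b)
        + (if a ≠ b ∧ a ≠ b.rev then (1 : K) else 0) • (E K a a ⊗ₖ E K b b)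
        + (if b < a then q ^ 2 - (q ^ 2)⁻¹ else 0) • (E K a b ⊗ₖ E K b a)
        - (if b < a then (q ^ 2 - (q ^ 2)⁻¹) * q ^ (rho n a - rho n b) else 0) •
            (E K a b ⊗ₖ E K a.rev b.rev)) := by
  have hc : ∀ c d e : K, (C c * (X + C d) * (X + C e) : K[X]).coeff 2 = c := by
    intro c d e
    have h : (C c * (X + C d) * (X + C e) : K[X]) =
        C c * X ^ 2 + C (c * (d + e)) * X + C (c * d * e) := by
      simp only [C_mul, C_add]; ring
    rw [h]
    simp only [coeff_add, coeff_C_mul, coeff_X_pow, coeff_X, coeff_C]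
    norm_num
  have hsum : ∀ {ι : Type} (s : Finset ι) (f : ι → Matrix (Fin (2 * n + 1) × Fin (2 * n + 1))
      (Fin (2 * n + 1) × Fin (2 * n + 1)) K[X]),
      (∑ i ∈ s, f i).map (fun p => p.coeff 2) = ∑ i ∈ s, (f i).map (fun p => p.coeff 2) := by
    intro ι s f
    ext u v
    simp [Matrix.sum_apply, finsetSum_coeff]
  have hadd : ∀ f g : Matrix (Fin (2 * n + 1) × Fin (2 * n + 1))
      (Fin (2 * n + 1) × Fin (2 * n + 1)) K[X],
      (f + g).map (fun p => p.coeff 2) =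
        f.map (fun p => p.coeff 2) + g.map (fun p => p.coeff 2) := by
    intro f g
    ext u v
    simp
  have hfold : ∑ a : Fin (2 * n + 1), (if a = a.rev then (1 : K) else (q ^ 2)⁻¹) •
          (E K a a ⊗ₖ E K a.rev a.rev) =
      ∑ a : Fin (2 * n + 1), ∑ b : Fin (2 * n + 1),
        (if a = b then (if a = a.rev then (1 : K) else (q ^ 2)⁻¹) else 0) •
          (E K a b ⊗ₖ E K a.rev b.rev) := by
    refine Finset.sum_congr rfl fun a _ => ?_
    rw [Finset.sum_eq_single a]
    · simp
    · intro b _ hb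
      simp [Ne.symm hb]
    · simp
  unfold rMatrix jimboR
  simp only [hsum, hadd, map_coeff_smul_single, Finset.smul_sum, smul_add, smul_smul,
    jimboCoeff_coeff_two q hq]
  rw [hfold, ← Finset.sum_add_distrib]
  refine Finset.sum_congr rfl fun a _ => ?_
  rw [← Finset.sum_add_distrib]
  refine Finset.sum_congr rfl fun b _ => ?_
  generalize (((q⁻¹ : K) ^ 2) ^ (2 * (n : ℤ) - 1)) = ξ
  have h1 : q ^ 2 * ((X - C (((q⁻¹ : K) ^ 2) ^ 2)) * (X - C ξ) : K[X]).coeff 2 = q ^ 2 := by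
    have := hc 1 (-(((q⁻¹ : K) ^ 2) ^ 2)) (-ξ)
    simp only [C_neg, C_1, one_mul, ← sub_eq_add_neg] at this
    rw [this, mul_one]
  have h2 : q ^ 2 * (C ((q⁻¹ : K) ^ 2) * (X - 1) * (X - C ξ) : K[X]).coeff 2 = 1 := by
    have := hc ((q⁻¹ : K) ^ 2) (-1) (-ξ)
    simp only [C_neg, C_1, ← sub_eq_add_neg] at this
    rw [this]
    field_simp
  have h3 : q ^ 2 * (-C (((q⁻¹ : K) ^ 2) ^ 2 - 1) * (X - C ξ) : K[X]).coeff 2 = 0 := by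
    have h : (-C (((q⁻¹ : K) ^ 2) ^ 2 - 1) * (X - C ξ) : K[X]) =
        C (-(((q⁻¹ : K) ^ 2) ^ 2 - 1)) * X + C ((((q⁻¹ : K) ^ 2) ^ 2 - 1) * ξ) := by
      simp only [C_mul, C_neg]; ring
    rw [h]
    simp only [coeff_add, coeff_C_mul, coeff_X_pow, coeff_X, coeff_C]
    norm_num
  have h4 : q ^ 2 * (-C (((q⁻¹ : K) ^ 2) ^ 2 - 1) * (X - C ξ) * X : K[X]).coeff 2 =
      q ^ 2 - (q ^ 2)⁻¹ := by
    have := hc (-(((q⁻¹ : K) ^ 2) ^ 2 - 1)) (-ξ) 0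
    simp only [C_neg, C_0, add_zero, ← sub_eq_add_neg] at this
    rw [this]
    field_simp
    ring
  simp only [apply_ite (fun p : K[X] => q ^ 2 * p.coeff 2), h1, h2, h3, h4, coeff_zero, mul_zero,
    ite_self, zero_smul, add_zero]
  by_cases hab : a = b
  · subst hab
    simp only [lt_irrefl, if_true, if_false, ne_eq, not_true_eq_false, false_and, true_and,
      zero_smul, add_zero, sub_zero]
    exact add_comm _ _
  · by_cases hr : a = b.rev
    · have hb : a.rev = b := by simp [hr]
      have hb' : b.rev = a := hr.symm
      by_cases hlt : b < a
      · simp only [hab, hlt, hb, hb', if_true, if_false, ne_eq, not_true_eq_false, not_false_eq_true,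
          and_false, false_and, zero_smul, add_zero, zero_add, mul_sub, mul_one, sub_smul]
      · simp [hab, hlt]
    · by_cases hlt : b < a
      · simp only [hab, hr, hlt, if_true, if_false, ne_eq, not_false_eq_true, and_self, false_and]
        module
      · simp [hab, hr, hlt]

/-! ### The algebra `A_q(B_n)` -/

/-- The free generator `t_{ij}`. -/
def tFree (K : Type*) [Field K] {n : ℕ} (i j : Fin (2 * n + 1)) :
    FreeAlgebra K (Fin (2 * n + 1) × Fin (2 * n + 1)) :=
  FreeAlgebra.ι K (i, j)

/-- The defining relations of `A_q(B_n)`: the `RTT` relations and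
`C_{jk} C_{lm} t_{ij} t_{lk} = C_{ij} C_{kl} t_{kj} t_{lm} = δ_{im}`
(repeated indices are summed). -/
inductive AqBRel (q : K) (n : ℕ) :
    FreeAlgebra K (Fin (2 * n + 1) × Fin (2 * n + 1)) →
    FreeAlgebra K (Fin (2 * n + 1) × Fin (2 * n + 1)) → Prop
  | rtt (i j k l : Fin (2 * n + 1)) : AqBRel q n
      (∑ m, ∑ p, rMatrix q n (i, j) (m, p) • (tFree K m k * tFree K p l))
      (∑ m, ∑ p, rMatrix q n (m, p) (k, l) • (tFree K j p * tFree K i m))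
  | orth_left (i m : Fin (2 * n + 1)) : AqBRel q n
      (∑ j, ∑ k, ∑ l, (cMatrix q n j k * cMatrix q n l m) • (tFree K i j * tFree K l k))
      (if i = m then 1 else 0)
  | orth_right (i m : Fin (2 * n + 1)) : AqBRel q n
      (∑ j, ∑ k, ∑ l, (cMatrix q n i j * cMatrix q n k l) • (tFree K k j * tFree K l m))
      (if i = m then 1 else 0)

/-- The algebra `A_q(B_n)`. -/
abbrev AqB (q : K) (n : ℕ) : Type _ := RingQuot (AqBRel q n)

/-- The generator `t_{ij}` of `A_q(B_n)`. -/
def t (q : K) (n : ℕ) (i j : Fin (2 * n + 1)) : AqB q n :=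
  RingQuot.mkAlgHom K (AqBRel q n) (tFree K i j)

/-! ### The `q`-oscillator algebra and its Fock representation -/

/-- The generators `a⁺`, `a⁻`, `k` of the `q`-oscillator algebra. -/
inductive OscGen : Type
  | aPlus | aMinus | k

/-- The defining relations of the `q`-oscillator algebra. -/
inductive OscRel (q : K) : FreeAlgebra K OscGen → FreeAlgebra K OscGen → Prop
  | k_aPlus : OscRel q (FreeAlgebra.ι K .k * FreeAlgebra.ι K .aPlus)
      (q • (FreeAlgebra.ι K .aPlus * FreeAlgebra.ι K .k))
  | k_aMinus : OscRel q (FreeAlgebra.ι K .k * FreeAlgebra.ι K .aMinus)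
      (q⁻¹ • (FreeAlgebra.ι K .aMinus * FreeAlgebra.ι K .k))
  | aMinus_aPlus : OscRel q (FreeAlgebra.ι K .aMinus * FreeAlgebra.ι K .aPlus)
      (1 - q ^ 2 • FreeAlgebra.ι K .k ^ 2)
  | aPlus_aMinus : OscRel q (FreeAlgebra.ι K .aPlus * FreeAlgebra.ι K .aMinus)
      (1 - FreeAlgebra.ι K .k ^ 2)

/-- The `q`-oscillator algebra `Osc_q`. -/
abbrev Osc (q : K) : Type _ := RingQuot (OscRel q)

/-- The generator `a⁺` of `Osc_q`. -/
def aPlus (q : K) : Osc q := RingQuot.mkAlgHom K (OscRel q) (FreeAlgebra.ι K .aPlus)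

/-- The generator `a⁻` of `Osc_q`. -/
def aMinus (q : K) : Osc q := RingQuot.mkAlgHom K (OscRel q) (FreeAlgebra.ι K .aMinus)

/-- The generator `k` of `Osc_q`. -/
def kk (q : K) : Osc q := RingQuot.mkAlgHom K (OscRel q) (FreeAlgebra.ι K .k)

/-- The Fock space `⊕_{m ≥ 0} K |m⟩`. -/
abbrev Fock (K : Type*) [Field K] : Type _ := ℕ →₀ K

/-- The basis vector `|m⟩`. -/
def ket (K : Type*) [Field K] (m : ℕ) : Fock K := Finsupp.single m 1

/-- The action of the generators on the Fock space: `a⁺|m⟩ = |m+1⟩`, `a⁻|m⟩ = (1 - q^{2m})|m-1⟩`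
(which is `0` for `m = 0`), `k|m⟩ = q^m|m⟩`. -/
def fockGen (q : K) : OscGen → Module.End K (Fock K)
  | .aPlus => Finsupp.linearCombination K fun m => ket K (m + 1)
  | .aMinus => Finsupp.linearCombination K fun m => (1 - q ^ (2 * m)) • ket K (m - 1)
  | .k => Finsupp.linearCombination K fun m => q ^ m • ket K m

theorem fockGen_rel (q : K) (hq : q ≠ 0) ⦃x y : FreeAlgebra K OscGen⦄ (h : OscRel q x y) :
    FreeAlgebra.lift K (fockGen q) x = FreeAlgebra.lift K (fockGen q) y := by
  cases h
  all_goals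
    refine Finsupp.lhom_ext' fun m => LinearMap.ext_ring ?_
    simp only [map_mul, map_smul, map_sub, map_one, map_pow, FreeAlgebra.lift_ι_apply, fockGen, ket,
      LinearMap.comp_apply, Finsupp.lsingle_apply, Module.End.mul_apply, LinearMap.smul_apply,
      LinearMap.sub_apply, Module.End.one_apply, Finsupp.linearCombination_single, one_smul, pow_two,
      smul_smul]
  · congr 1
    ring
  · cases m with
    | zero => simp
    | succ m =>
      simp only [Nat.add_sub_cancel]
      congr 1
      field_simp
      ring
  · simp only [Nat.add_sub_cancel]
    module
  · cases m with
    | zero => simp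
    | succ m =>
      simp only [Nat.add_sub_cancel]
      module

/-- The representation of `Osc_q` on the Fock space `ℱ_q`. -/
def fock (q : K) (hq : q ≠ 0) : Osc q →ₐ[K] Module.End K (Fock K) :=
  RingQuot.liftAlgHom K ⟨FreeAlgebra.lift K (fockGen q), fockGen_rel q hq⟩

/-- A representation `ρ` of a `K`-algebra `A` on `V` is irreducible: `V ≠ 0`, and the only
invariant subspaces are `0` and `V`. -/
def IsIrreducibleRep {A V : Type*} [Ring A] [Algebra K A] [AddCommGroup V] [Module K V]
    (ρ : A →ₐ[K] Module.End K V) : Prop :=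
  Nontrivial V ∧ ∀ W : Submodule K V, (∀ a : A, ∀ w ∈ W, ρ a w ∈ W) → W = ⊥ ∨ W = ⊤

/-! ### The matrices of images of the generators of `A_q(B_3)` -/

/-- The matrix `π₁` over `Osc_{q²}`. -/
def piMat₁ (q α β μ ν κ σ : K) : Matrix (Fin 7) (Fin 7) (Osc (q ^ 2)) :=
  let Ap := aPlus (q ^ 2)
  let Am := aMinus (q ^ 2)
  let Kk := kk (q ^ 2)
  !![μ • Am, α • Kk, 0,     0,     0,       0,                   0;
     β • Kk, ν • Ap, 0,     0,     0,       0,                   0;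
     0,      0,      κ • 1, 0,     0,       0,                   0;
     0,      0,      0,     σ • 1, 0,       0,                   0;
     0,      0,      0,     0,     κ⁻¹ • 1, 0,                   0;
     0,      0,      0,     0,     0,       ν⁻¹ • Am,            (q ^ 2 * β⁻¹) • Kk;
     0,      0,      0,     0,     0,       (q ^ 2 * α⁻¹) • Kk,  μ⁻¹ • Ap]

/-- The matrix `π₂` over `Osc_{q²}`. -/
def piMat₂ (q α β μ ν κ σ : K) : Matrix (Fin 7) (Fin 7) (Osc (q ^ 2)) :=
  let Ap := aPlus (q ^ 2)
  let Am := aMinus (q ^ 2)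
  let Kk := kk (q ^ 2)
  !![κ • 1, 0,      0,      0,     0,                  0,                  0;
     0,     μ • Am, α • Kk, 0,     0,                  0,                  0;
     0,     β • Kk, ν • Ap, 0,     0,                  0,                  0;
     0,     0,      0,      σ • 1, 0,                  0,                  0;
     0,     0,      0,      0,     ν⁻¹ • Am,           (q ^ 2 * β⁻¹) • Kk, 0;
     0,     0,      0,      0,     (q ^ 2 * α⁻¹) • Kk, μ⁻¹ • Ap,           0;
     0,     0,      0,      0,     0,                  0,                  κ⁻¹ • 1]

/-- The matrix `π₃` over `Osc_q`, with `r = 1 + q²`. -/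
def piMat₃ (q α μ κ₁ κ₂ : K) : Matrix (Fin 7) (Fin 7) (Osc q) :=
  let ap := aPlus q
  let am := aMinus q
  let k := kk q
  let r : K := 1 + q ^ 2
  !![κ₁ • 1, 0, 0, 0, 0, 0, 0;
     0, κ₂ • 1, 0, 0, 0, 0, 0;
     0, 0, μ • am ^ 2, α • (k * am), (-((r * μ)⁻¹ * α ^ 2)) • k ^ 2, 0, 0;
     0, 0, (-(r * α⁻¹ * μ)) • (am * k), am * ap - k ^ 2, (-((q * μ)⁻¹ * α)) • (k * ap), 0, 0;
     0, 0, (-(r * (q * α⁻¹) ^ 2 * μ)) • k ^ 2, (r * α⁻¹) • (k * ap), μ⁻¹ • ap ^ 2, 0, 0;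
     0, 0, 0, 0, 0, κ₂⁻¹ • 1, 0;
     0, 0, 0, 0, 0, 0, κ₁⁻¹ • 1]

end QFun

end

namespace QFun

variable {K : Type*} [Field K]

/-! A homomorphism out of `A_q(B_3)` is a matrix satisfying the defining relations, and it is unique
because the `t_{ij}` generate. Existence is therefore a finite verification, made feasible by two
observations. First, `R` and `C` are sparse: an `RTT` relation has at most a diagonal term and a
flip term on each side, plus a contraction sum when the free pair is of the form `(i, i')`
(`exists_algHom_of_relations`). Second, the matrices are block diagonal and reversal of indices
permutes the blocks, so many `RTT` relations read `0 = 0` (`rttAt_of_vanishes`). The remaining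
relations follow by normal ordering: the oscillator relations move `a⁺` and `a⁻` to the left of `k`
and eliminate mixed products, after which coefficients are compared as rational functions of `q` and
the parameters.

Irreducibility uses only two matrix entries, one lowering and one raising the Fock degree by one
with nonzero coefficients (`isIrreducibleRep_of_ladder`). Lowering takes any nonzero vector to a
multiple of the vacuum, and raising then produces every basis vector. The coefficients do not vanish
because `q` is not a root of unity. -/

/-! ### Sparse form of `R` and `C`, and the evaluated relations -/

/-- The diagonal entry of the constant `R` matrix at `(i, j)`. -/
def rDiag (q : K) {N : ℕ} (i j : Fin N) : K :=
  if j = i.rev then (if i = j then 1 else (q ^ 2)⁻¹) else if i = j then q ^ 2 else 1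

theorem kronecker_E_apply {N : ℕ} (a b c d i j m p : Fin N) :
    (E K a b ⊗ₖ E K c d) (i, j) (m, p) =
      if a = i then if b = m then if c = j then if d = p then 1 else 0 else 0 else 0 else 0 := by
  simp only [E, Matrix.kroneckerMap_apply, Matrix.single_apply]
  split_ifs <;> simp_all

/-- The summands are the diagonal part, the flip part and the contraction part of `R`. Each is
supported on explicit index equalities, so sums against `R` collapse. -/
theorem rMatrix_apply (q : K) (hq : q ≠ 0) (n : ℕ) (i j m p : Fin (2 * n + 1)) :
    rMatrix q n (i, j) (m, p) =
      (if i = m then if j = p then rDiag q i j else 0 else 0)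
      + (if j = m then if i = p then if j < i then q ^ 2 - (q ^ 2)⁻¹ else 0 else 0 else 0)
      - (if j = i.rev then if p = m.rev then
          if m < i then (q ^ 2 - (q ^ 2)⁻¹) * q ^ (rho n i - rho n m) else 0 else 0 else 0) := by
  have hrev : ∀ a b : Fin (2 * n + 1), a.rev = b ↔ b = a.rev := fun a b => eq_comm
  simp only [rMatrix_eq q hq, Matrix.add_apply, Matrix.sub_apply, Matrix.sum_apply,
    Matrix.smul_apply, smul_eq_mul, kronecker_E_apply, mul_ite, mul_one, mul_zero,
    Finset.sum_add_distrib, Finset.sum_sub_distrib, Finset.sum_ite_eq',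
    Finset.mem_univ, if_true, Finset.sum_ite_irrel, Finset.sum_const_zero, hrev]
  have hswap : (if m = j then if i = p then if m < i then q ^ 2 - (q ^ 2)⁻¹ else 0 else 0 else 0)
      = if j = m then if i = p then if j < i then q ^ 2 - (q ^ 2)⁻¹ else 0 else 0 else 0 := by
    by_cases h : j = m
    · simp [h]
    · simp [h, Ne.symm h]
  -- The three diagonal families of `rMatrix_eq` have disjoint supports and together fill the
  -- diagonal. The middle index, which is its own reverse, belongs to the first family and has value
  -- `1`.
  have hdiag : (if i = m then if j = i.rev then if p = i.rev then
        if i = i.rev then 1 else (q ^ 2)⁻¹ else 0 else 0 else 0)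
      + (if i = m then if j = p then if i = j ∧ i ≠ i.rev then q ^ 2 else 0 else 0 else 0)
      + (if i = m then if j = p then if i ≠ j ∧ i ≠ j.rev then 1 else 0 else 0 else 0)
      = if i = m then if j = p then rDiag q i j else 0 else 0 := by
    have hij : i = j.rev ↔ j = i.rev := by rw [eq_comm, Fin.rev_eq_iff]
    by_cases hm : i = m
    · by_cases hp : j = p
      · subst hp
        by_cases hr : j = i.rev
        · subst hr
          by_cases hi : i = i.rev
          · simp only [rDiag, eq_true hi, Fin.rev_rev, if_true, hm]; simp
          · simp only [rDiag, eq_false hi, Fin.rev_rev, if_true, hm]; simp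
        · by_cases hi : i = j
          · subst hi; simp [rDiag, hr]
          · simp [rDiag, hr, hi, hij]
      · by_cases hr : j = i.rev
        · simp [hp, ← hr, Ne.symm hp]
        · simp [hp, hr]
    · simp [hm]
  rw [hswap, ← hdiag]
  ring

variable {A : Type*} [Ring A] [Algebra K A]

theorem sum_rMatrix_row_smul (q : K) (hq : q ≠ 0) (n : ℕ) (f : Fin (2 * n + 1) → Fin (2 * n + 1) → A)
    (i j : Fin (2 * n + 1)) :
    ∑ m, ∑ p, rMatrix q n (i, j) (m, p) • f m p =
      rDiag q i j • f i j + (if j < i then q ^ 2 - (q ^ 2)⁻¹ else 0) • f j i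
      - if j = i.rev then ∑ b, (if b < i then (q ^ 2 - (q ^ 2)⁻¹) * q ^ (rho n i - rho n b) else 0) •
          f b b.rev else 0 := by
  simp only [rMatrix_apply q hq, sub_smul, add_smul, ite_smul, zero_smul, Finset.sum_add_distrib,
    Finset.sum_sub_distrib, Finset.sum_ite_irrel, Finset.sum_const_zero, Finset.sum_ite_eq,
    Finset.sum_ite_eq', Finset.mem_univ, if_true]

theorem sum_rMatrix_col_smul (q : K) (hq : q ≠ 0) (n : ℕ) (f : Fin (2 * n + 1) → Fin (2 * n + 1) → A)
    (k l : Fin (2 * n + 1)) :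
    ∑ m, ∑ p, rMatrix q n (m, p) (k, l) • f m p =
      rDiag q k l • f k l + (if k < l then q ^ 2 - (q ^ 2)⁻¹ else 0) • f l k
      - if l = k.rev then ∑ a, (if k < a then (q ^ 2 - (q ^ 2)⁻¹) * q ^ (rho n a - rho n k) else 0) •
          f a a.rev else 0 := by
  simp only [rMatrix_apply q hq, sub_smul, add_smul, ite_smul, zero_smul, Finset.sum_add_distrib,
    Finset.sum_sub_distrib, Finset.sum_ite_irrel, Finset.sum_const_zero, Finset.sum_ite_eq,
    Finset.sum_ite_eq', Finset.mem_univ, if_true]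

theorem rho_rev (n : ℕ) (i : Fin (2 * n + 1)) : rho n i.rev = -rho n i := by
  simp only [rho, Fin.val_rev]
  split_ifs <;> grind

theorem sum_cMatrix_left_smul (q : K) (hq : q ≠ 0) (n : ℕ)
    (T : Fin (2 * n + 1) → Fin (2 * n + 1) → A) (i m : Fin (2 * n + 1)) :
    ∑ j, ∑ k, ∑ l, (cMatrix q n j k * cMatrix q n l m) • (T i j * T l k) =
      ∑ j, q ^ (rho n m - rho n j) • (T i j * T m.rev j.rev) := by
  have hrev : ∀ a b : Fin (2 * n + 1), a = b.rev ↔ b = a.rev := fun a b => by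
    rw [eq_comm, Fin.rev_eq_iff]
  have hrev' : ∀ l : Fin (2 * n + 1), l = m.rev ↔ m.rev = l := fun l => eq_comm
  refine Finset.sum_congr rfl fun j _ => ?_
  simp only [cMatrix, ite_mul, zero_mul, mul_ite, mul_zero, ite_smul, zero_smul, hrev j,
    hrev', Finset.sum_ite_eq, Finset.sum_ite_eq', Finset.mem_univ, if_true, rho_rev,
    ← zpow_add₀ hq]
  congr 2
  ring

theorem sum_cMatrix_right_smul (q : K) (hq : q ≠ 0) (n : ℕ)
    (T : Fin (2 * n + 1) → Fin (2 * n + 1) → A) (i m : Fin (2 * n + 1)) :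
    ∑ j, ∑ k, ∑ l, (cMatrix q n i j * cMatrix q n k l) • (T k j * T l m) =
      ∑ k, q ^ (-rho n i - rho n k) • (T k i.rev * T k.rev m) := by
  have hrev : ∀ a b : Fin (2 * n + 1), a = b.rev ↔ b = a.rev := fun a b => by
    rw [eq_comm, Fin.rev_eq_iff]
  -- `C_{ij}` fixes `j` and `C_{kl}` fixes `l`, so `k` is the index that survives and has to be
  -- outermost.
  rw [Finset.sum_comm]
  refine Finset.sum_congr rfl fun k _ => ?_
  simp only [cMatrix, ite_mul, zero_mul, mul_ite, mul_zero, ite_smul, zero_smul, hrev,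
    Finset.sum_ite_eq', Finset.sum_ite_irrel, Finset.sum_const_zero, Finset.mem_univ, if_true,
    rho_rev, ← zpow_add₀ hq]
  congr 2

/-- Matrices satisfying the defining relations of `A_q(B_n)` in evaluated form define
representations of `A_q(B_n)`. -/
theorem exists_algHom_of_relations (q : K) (hq : q ≠ 0) (n : ℕ)
    (T : Fin (2 * n + 1) → Fin (2 * n + 1) → A)
    (hrtt : ∀ i j k l,
      rDiag q i j • (T i k * T j l) + (if j < i then q ^ 2 - (q ^ 2)⁻¹ else 0) • (T j k * T i l)
        - (if j = i.rev then ∑ b, (if b < i then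
            (q ^ 2 - (q ^ 2)⁻¹) * q ^ (rho n i - rho n b) else 0) • (T b k * T b.rev l) else 0) =
      rDiag q k l • (T j l * T i k) + (if k < l then q ^ 2 - (q ^ 2)⁻¹ else 0) • (T j k * T i l)
        - if l = k.rev then ∑ a, (if k < a then
            (q ^ 2 - (q ^ 2)⁻¹) * q ^ (rho n a - rho n k) else 0) • (T j a.rev * T i a) else 0)
    (hleft : ∀ i m, ∑ j, q ^ (rho n m - rho n j) • (T i j * T m.rev j.rev) = if i = m then 1 else 0)
    (hright : ∀ i m, ∑ k, q ^ (-rho n i - rho n k) • (T k i.rev * T k.rev m) =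
      if i = m then 1 else 0) :
    ∃ φ : AqB q n →ₐ[K] A, ∀ i j, φ (t q n i j) = T i j := by
  refine ⟨RingQuot.liftAlgHom K ⟨FreeAlgebra.lift K fun x => T x.1 x.2, fun x y h => ?_⟩,
    fun i j => by simp [t, tFree]⟩
  cases h with
  | rtt i j k l =>
    simp only [map_sum, map_smul, map_mul, tFree, FreeAlgebra.lift_ι_apply]
    rw [sum_rMatrix_row_smul q hq n (fun m p => T m k * T p l),
      sum_rMatrix_col_smul q hq n (fun m p => T j p * T i m)]
    exact hrtt i j k l
  | orth_left i m =>
    simp only [map_sum, map_smul, map_mul, tFree, FreeAlgebra.lift_ι_apply]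
    rw [sum_cMatrix_left_smul q hq, hleft]
    split_ifs <;> simp
  | orth_right i m =>
    simp only [map_sum, map_smul, map_mul, tFree, FreeAlgebra.lift_ι_apply]
    rw [sum_cMatrix_right_smul q hq, hright]
    split_ifs <;> simp

/-- Homomorphisms out of `A_q(B_n)` are determined by their values on the generators. -/
theorem AqB_algHom_ext {q : K} {n : ℕ} {φ ψ : AqB q n →ₐ[K] A}
    (h : ∀ i j, φ (t q n i j) = ψ (t q n i j)) : φ = ψ := by
  refine RingQuot.ringQuot_ext' K _ _ (FreeAlgebra.hom_ext (funext fun x => ?_))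
  exact h x.1 x.2

/-! ### Rank three: block structure and oscillator relations -/

theorem forall_fin_seven {P : Fin 7 → Prop} (h0 : P 0) (h1 : P 1) (h2 : P 2) (h3 : P 3) (h4 : P 4)
    (h5 : P 5) (h6 : P 6) (i : Fin 7) : P i := by
  fin_cases i <;> assumption

theorem rho_three_zero : rho 3 0 = 5 := rfl
theorem rho_three_one : rho 3 1 = 3 := rfl
theorem rho_three_two : rho 3 2 = 1 := rfl
theorem rho_three_three : rho 3 3 = 0 := rfl
theorem rho_three_four : rho 3 4 = -1 := rfl
theorem rho_three_five : rho 3 5 = -3 := rfl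
theorem rho_three_six : rho 3 6 = -5 := rfl

/-- The evaluated `RTT` relation at `(i, j, k, l)` in rank three. -/
def RTTAt (q : K) (T : Matrix (Fin 7) (Fin 7) A) (i j k l : Fin 7) : Prop :=
  rDiag q i j • (T i k * T j l) + (if j < i then q ^ 2 - (q ^ 2)⁻¹ else 0) • (T j k * T i l)
    - (if j = i.rev then ∑ b, (if b < i then
        (q ^ 2 - (q ^ 2)⁻¹) * q ^ (rho 3 i - rho 3 b) else 0) • (T b k * T b.rev l) else 0) =
  rDiag q k l • (T j l * T i k) + (if k < l then q ^ 2 - (q ^ 2)⁻¹ else 0) • (T j k * T i l)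
    - if l = k.rev then ∑ a, (if k < a then
        (q ^ 2 - (q ^ 2)⁻¹) * q ^ (rho 3 a - rho 3 k) else 0) • (T j a.rev * T i a) else 0

/-- For a block diagonal `T` with block labels `c` reversed by `x ↦ d - x`, this forces every term
of the `RTT` relation at `(i, j, k, l)` to vanish. -/
def rttVanishes (c : Fin 7 → ℕ) (d : ℕ) (i j k l : Fin 7) : Bool :=
  !(Nat.beq (c i) (c k) && Nat.beq (c j) (c l)) && !(Nat.beq (c j) (c k) && Nat.beq (c i) (c l)) &&
    (!(Nat.beq (i + j) 6) || !(Nat.beq (c k + c l) d)) &&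
    (!(Nat.beq (k + l) 6) || !(Nat.beq (c i + c j) d))

/-- A product of two entries survives only if row and column labels agree in each factor. In a
contraction sum the two summed indices are reverses of each other, so their labels add up to `d`; a
surviving term forces the two free labels to add up to `d` as well. -/
theorem rttAt_of_vanishes (q : K) {T : Matrix (Fin 7) (Fin 7) A} {c : Fin 7 → ℕ} {d : ℕ}
    (hc : ∀ i, c i + c i.rev = d) (hT : ∀ i j, c i ≠ c j → T i j = 0) {i j k l : Fin 7}
    (h : rttVanishes c d i j k l = true) : RTTAt q T i j k l := by
  have hmul : ∀ i j k l, ¬(c i = c k ∧ c j = c l) → T i k * T j l = 0 := by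
    intro i j k l h
    rcases not_and_or.1 h with h | h <;> simp [hT _ _ h]
  have hrev : ∀ i j : Fin 7, j = i.rev → (i + j : ℕ) = 6 := by
    rintro i j rfl
    rw [Fin.val_rev]
    lia
  simp only [rttVanishes, Bool.and_eq_true, Bool.or_eq_true, Bool.not_eq_true', ← Bool.not_eq_true,
    Nat.beq_eq] at h
  obtain ⟨⟨⟨h1, h2⟩, h3⟩, h4⟩ := h
  have e3 : (if j = i.rev then ∑ b, (if b < i then
        (q ^ 2 - (q ^ 2)⁻¹) * q ^ (rho 3 i - rho 3 b) else 0) • (T b k * T b.rev l) else 0) = 0 := by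
    split_ifs with hj
    · refine Finset.sum_eq_zero fun b _ => ?_
      rw [hmul _ _ _ _ fun hb => h3.resolve_left (not_not.2 (hrev i j hj)) ?_, smul_zero]
      rw [← hb.1, ← hb.2, hc]
    · rfl
  have e4 : (if l = k.rev then ∑ a, (if k < a then
        (q ^ 2 - (q ^ 2)⁻¹) * q ^ (rho 3 a - rho 3 k) else 0) • (T j a.rev * T i a) else 0) = 0 := by
    split_ifs with hl
    · refine Finset.sum_eq_zero fun a _ => ?_
      rw [hmul _ _ _ _ fun ha => h4.resolve_left (not_not.2 (hrev k l hl)) ?_, smul_zero]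
      rw [ha.1, ha.2, hc]
    · rfl
  rw [RTTAt, e3, e4, hmul _ _ _ _ h1, hmul _ _ _ _ fun h => h1 h.symm, hmul _ _ _ _ h2]
  simp

/-- Elements `ap`, `am`, `k` of an algebra satisfying the `q`-oscillator relations. -/
structure IsOscillator (q : K) (ap am k : A) : Prop where
  k_ap : k * ap = q • (ap * k)
  k_am : k * am = q⁻¹ • (am * k)
  am_ap : am * ap = 1 - q ^ 2 • (k * k)
  ap_am : ap * am = 1 - k * k

theorem isOscillator_osc (q : K) : IsOscillator q (aPlus q) (aMinus q) (kk q) where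
  k_ap := by simpa [aPlus, aMinus, kk, pow_two] using RingQuot.mkAlgHom_rel K (OscRel.k_aPlus (q := q))
  k_am := by simpa [aPlus, aMinus, kk, pow_two] using RingQuot.mkAlgHom_rel K (OscRel.k_aMinus (q := q))
  am_ap := by simpa [aPlus, aMinus, kk, pow_two] using RingQuot.mkAlgHom_rel K (OscRel.aMinus_aPlus (q := q))
  ap_am := by simpa [aPlus, aMinus, kk, pow_two] using RingQuot.mkAlgHom_rel K (OscRel.aPlus_aMinus (q := q))

/-- A matrix satisfying the defining relations of `A_q(B_3)` defines a unique homomorphism. -/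
theorem existsUnique_algHom_of_relations {q : K} (hq : q ≠ 0) (T : Matrix (Fin 7) (Fin 7) A)
    (hrtt : ∀ i j k l, RTTAt q T i j k l)
    (hleft : ∀ i m, ∑ j, q ^ (rho 3 m - rho 3 j) • (T i j * T m.rev j.rev) = if i = m then 1 else 0)
    (hright : ∀ i m, ∑ k, q ^ (-rho 3 i - rho 3 k) • (T k i.rev * T k.rev m) =
      if i = m then 1 else 0) :
    ∃ φ : AqB q 3 →ₐ[K] A, (∀ i j, φ (t q 3 i j) = T i j) ∧
      ∀ ψ : AqB q 3 →ₐ[K] A, (∀ i j, ψ (t q 3 i j) = T i j) → ψ = φ := by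
  obtain ⟨φ, hφ⟩ := exists_algHom_of_relations q hq 3 T hrtt hleft hright
  exact ⟨φ, hφ, fun ψ hψ => AqB_algHom_ext fun i j => (hψ i j).trans (hφ i j).symm⟩

/-! ### The relations for `π₁` -/

/-- The matrix `piMat₁` with entries in an arbitrary algebra with oscillator elements. -/
def oscMatrix₁ (q α β μ ν κ σ : K) (ap am k : A) : Matrix (Fin 7) (Fin 7) A :=
  !![μ • am, α • k, 0,     0,     0,       0,                   0;
     β • k, ν • ap, 0,     0,     0,       0,                   0;
     0,      0,      κ • 1, 0,     0,       0,                   0;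
     0,      0,      0,     σ • 1, 0,       0,                   0;
     0,      0,      0,     0,     κ⁻¹ • 1, 0,                   0;
     0,      0,      0,     0,     0,       ν⁻¹ • am,            (q ^ 2 * β⁻¹) • k;
     0,      0,      0,     0,     0,       (q ^ 2 * α⁻¹) • k,  μ⁻¹ • ap]

/-- The labels of the diagonal blocks of `oscMatrix₁`. -/
def blockLabel₁ : Fin 7 → ℕ := ![0, 0, 1, 2, 3, 4, 4]

theorem oscMatrix₁_apply_eq_zero (q α β μ ν κ σ : K) (ap am k : A) (i j : Fin 7)
    (h : blockLabel₁ i ≠ blockLabel₁ j) : oscMatrix₁ q α β μ ν κ σ ap am k i j = 0 := by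
  revert i j
  apply forall_fin_seven <;> apply forall_fin_seven <;>
    first | exact fun h => (h rfl).elim | exact fun _ => rfl

theorem blockLabel₁_add_rev (i : Fin 7) : blockLabel₁ i + blockLabel₁ i.rev = 4 := by
  revert i
  decide

set_option maxHeartbeats 4000000 in
theorem rttAt_oscMatrix₁ {q α β μ ν κ σ : K} (hq : q ≠ 0) (hα : α ≠ 0)
    (hμ : μ ≠ 0) (hν : ν ≠ 0) (hκ : κ ≠ 0) (h : α * β = -q ^ 2 * μ * ν) (hσ : σ * σ = 1)
    {ap am k : A} (ho : IsOscillator (q ^ 2) ap am k) (i j k' l : Fin 7) :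
    RTTAt q (oscMatrix₁ q α β μ ν κ σ ap am k) i j k' l := by
  obtain ⟨h1, h2, h3, h4⟩ := ho
  -- Solving the constraint for `β` leaves independent nonzero parameters, so the coefficient
  -- identities become plain identities of rational functions.
  obtain rfl : β = -(q ^ 2 * μ * ν * α⁻¹) := by
    field_simp
    linear_combination h
  generalize hT : oscMatrix₁ q α _ μ ν κ σ ap am k = T
  have hz : ∀ i j, blockLabel₁ i ≠ blockLabel₁ j → T i j = 0 :=
    hT ▸ oscMatrix₁_apply_eq_zero q α _ μ ν κ σ ap am k
  revert i j k' l
  apply forall_fin_seven <;> apply forall_fin_seven <;> apply forall_fin_seven <;>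
    apply forall_fin_seven <;>
    try exact rttAt_of_vanishes q blockLabel₁_add_rev hz rfl
  all_goals
    subst hT
    simp only [RTTAt, rDiag, rho_three_zero, rho_three_one, rho_three_two, rho_three_three,
      rho_three_four, rho_three_five, rho_three_six, Fin.sum_univ_seven, Fin.isValue, Fin.reduceEq,
      Fin.reduceLT, Fin.reduceRev, Int.reduceSub, Int.reduceNeg, if_true, if_false, zero_smul]
    try simp only [oscMatrix₁, Matrix.of_apply, Matrix.cons_val]
    -- Normal ordering: `h1` and `h2` move `k` to the right, while `h3` and `h4` replace mixed
    -- products of `ap` and `am` by polynomials in `k`. What remains is a comparison of coefficients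
    -- of ordered words.
    try simp only [mul_zero, zero_mul, smul_zero, add_zero, zero_add, sub_zero, smul_mul_assoc,
      mul_smul_comm, smul_smul, one_mul, mul_one, smul_sub, h1, h2, h3, h4, hσ]
  all_goals match_scalars <;> field_simp <;> ring

-- Reversal pairs the block on `{0, 1}` with the block on `{5, 6}`, and the relations say that these
-- are inverse to each other up to reflection and powers of `q`. The diagonal entries use the
-- oscillator relations, the off-diagonal ones cancel by `α * β = -q ^ 2 * μ * ν`, and the middle
-- entry is `σ * σ = 1`.
set_option maxHeartbeats 4000000 in
theorem orth_oscMatrix₁ {q α β μ ν κ σ : K} (hq : q ≠ 0) (hα : α ≠ 0)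
    (hμ : μ ≠ 0) (hν : ν ≠ 0) (hκ : κ ≠ 0) (h : α * β = -q ^ 2 * μ * ν) (hσ : σ * σ = 1)
    {ap am k : A} (ho : IsOscillator (q ^ 2) ap am k) (i m : Fin 7) :
    ∑ j : Fin 7, q ^ (rho 3 m - rho 3 j) •
        (oscMatrix₁ q α β μ ν κ σ ap am k i j * oscMatrix₁ q α β μ ν κ σ ap am k m.rev j.rev) =
        (if i = m then 1 else 0) ∧
      ∑ j : Fin 7, q ^ (-rho 3 i - rho 3 j) •
        (oscMatrix₁ q α β μ ν κ σ ap am k j i.rev * oscMatrix₁ q α β μ ν κ σ ap am k j.rev m) =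
        (if i = m then 1 else 0) := by
  obtain ⟨h1, h2, h3, h4⟩ := ho
  obtain rfl : β = -(q ^ 2 * μ * ν * α⁻¹) := by
    field_simp
    linear_combination h
  generalize hT : oscMatrix₁ q α _ μ ν κ σ ap am k = T
  revert i m
  apply forall_fin_seven <;> apply forall_fin_seven <;> constructor
  all_goals
    subst hT
    simp only [rho_three_zero, rho_three_one, rho_three_two, rho_three_three,
      rho_three_four, rho_three_five, rho_three_six, Fin.sum_univ_seven, Fin.isValue, Fin.reduceEq,
      Fin.reduceLT, Fin.reduceRev, Int.reduceSub, Int.reduceNeg, if_true, if_false, zero_smul]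
    try simp only [oscMatrix₁, Matrix.of_apply, Matrix.cons_val]
    try simp only [mul_zero, zero_mul, smul_zero, add_zero, zero_add, sub_zero, smul_mul_assoc,
      mul_smul_comm, smul_smul, one_mul, mul_one, smul_sub, h1, h2, h3, h4, hσ]
  all_goals match_scalars <;> field_simp <;> ring

/-! ### The relations for `π₂` -/

/-- The matrix `piMat₂` with entries in an arbitrary algebra with oscillator elements. -/
def oscMatrix₂ (q α β μ ν κ σ : K) (ap am k : A) : Matrix (Fin 7) (Fin 7) A :=
  !![κ • 1, 0,      0,      0,     0,                  0,                  0;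
     0,     μ • am, α • k, 0,     0,                  0,                  0;
     0,     β • k, ν • ap, 0,     0,                  0,                  0;
     0,     0,      0,      σ • 1, 0,                  0,                  0;
     0,     0,      0,      0,     ν⁻¹ • am,           (q ^ 2 * β⁻¹) • k, 0;
     0,     0,      0,      0,     (q ^ 2 * α⁻¹) • k, μ⁻¹ • ap,           0;
     0,     0,      0,      0,     0,                  0,                  κ⁻¹ • 1]

/-- The labels of the diagonal blocks of `oscMatrix₂`. -/
def blockLabel₂ : Fin 7 → ℕ := ![0, 1, 1, 2, 3, 3, 4]

theorem oscMatrix₂_apply_eq_zero (q α β μ ν κ σ : K) (ap am k : A) (i j : Fin 7)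
    (h : blockLabel₂ i ≠ blockLabel₂ j) : oscMatrix₂ q α β μ ν κ σ ap am k i j = 0 := by
  revert i j
  apply forall_fin_seven <;> apply forall_fin_seven <;>
    first | exact fun h => (h rfl).elim | exact fun _ => rfl

theorem blockLabel₂_add_rev (i : Fin 7) : blockLabel₂ i + blockLabel₂ i.rev = 4 := by
  revert i
  decide

set_option maxHeartbeats 4000000 in
theorem rttAt_oscMatrix₂ {q α β μ ν κ σ : K} (hq : q ≠ 0) (hα : α ≠ 0)
    (hμ : μ ≠ 0) (hν : ν ≠ 0) (hκ : κ ≠ 0) (h : α * β = -q ^ 2 * μ * ν) (hσ : σ * σ = 1)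
    {ap am k : A} (ho : IsOscillator (q ^ 2) ap am k) (i j k' l : Fin 7) :
    RTTAt q (oscMatrix₂ q α β μ ν κ σ ap am k) i j k' l := by
  obtain ⟨h1, h2, h3, h4⟩ := ho
  obtain rfl : β = -(q ^ 2 * μ * ν * α⁻¹) := by
    field_simp
    linear_combination h
  generalize hT : oscMatrix₂ q α _ μ ν κ σ ap am k = T
  have hz : ∀ i j, blockLabel₂ i ≠ blockLabel₂ j → T i j = 0 :=
    hT ▸ oscMatrix₂_apply_eq_zero q α _ μ ν κ σ ap am k
  revert i j k' l
  apply forall_fin_seven <;> apply forall_fin_seven <;> apply forall_fin_seven <;>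
    apply forall_fin_seven <;>
    try exact rttAt_of_vanishes q blockLabel₂_add_rev hz rfl
  all_goals
    subst hT
    simp only [RTTAt, rDiag, rho_three_zero, rho_three_one, rho_three_two, rho_three_three,
      rho_three_four, rho_three_five, rho_three_six, Fin.sum_univ_seven, Fin.isValue, Fin.reduceEq,
      Fin.reduceLT, Fin.reduceRev, Int.reduceSub, Int.reduceNeg, if_true, if_false, zero_smul]
    try simp only [oscMatrix₂, Matrix.of_apply, Matrix.cons_val]
    try simp only [mul_zero, zero_mul, smul_zero, add_zero, zero_add, sub_zero, smul_mul_assoc,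
      mul_smul_comm, smul_smul, one_mul, mul_one, smul_sub, h1, h2, h3, h4, hσ]
  all_goals match_scalars <;> field_simp <;> ring

-- The paired blocks are now on `{1, 2}` and `{4, 5}`. Since `rho` drops by `2` across each of them,
-- as it does for `π₁`, the same block identities occur.
set_option maxHeartbeats 4000000 in
theorem orth_oscMatrix₂ {q α β μ ν κ σ : K} (hq : q ≠ 0) (hα : α ≠ 0)
    (hμ : μ ≠ 0) (hν : ν ≠ 0) (hκ : κ ≠ 0) (h : α * β = -q ^ 2 * μ * ν) (hσ : σ * σ = 1)
    {ap am k : A} (ho : IsOscillator (q ^ 2) ap am k) (i m : Fin 7) :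
    ∑ j : Fin 7, q ^ (rho 3 m - rho 3 j) •
        (oscMatrix₂ q α β μ ν κ σ ap am k i j * oscMatrix₂ q α β μ ν κ σ ap am k m.rev j.rev) =
        (if i = m then 1 else 0) ∧
      ∑ j : Fin 7, q ^ (-rho 3 i - rho 3 j) •
        (oscMatrix₂ q α β μ ν κ σ ap am k j i.rev * oscMatrix₂ q α β μ ν κ σ ap am k j.rev m) =
        (if i = m then 1 else 0) := by
  obtain ⟨h1, h2, h3, h4⟩ := ho
  obtain rfl : β = -(q ^ 2 * μ * ν * α⁻¹) := by
    field_simp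
    linear_combination h
  generalize hT : oscMatrix₂ q α _ μ ν κ σ ap am k = T
  revert i m
  apply forall_fin_seven <;> apply forall_fin_seven <;> constructor
  all_goals
    subst hT
    simp only [rho_three_zero, rho_three_one, rho_three_two, rho_three_three,
      rho_three_four, rho_three_five, rho_three_six, Fin.sum_univ_seven, Fin.isValue, Fin.reduceEq,
      Fin.reduceLT, Fin.reduceRev, Int.reduceSub, Int.reduceNeg, if_true, if_false, zero_smul]
    try simp only [oscMatrix₂, Matrix.of_apply, Matrix.cons_val]
    try simp only [mul_zero, zero_mul, smul_zero, add_zero, zero_add, sub_zero, smul_mul_assoc,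
      mul_smul_comm, smul_smul, one_mul, mul_one, smul_sub, h1, h2, h3, h4, hσ]
  all_goals match_scalars <;> field_simp <;> ring

/-! ### The relations for `π₃` -/

/-- The matrix `piMat₃` with entries in an arbitrary algebra with oscillator elements. -/
def oscMatrix₃ (q α μ κ₁ κ₂ : K) (ap am k : A) : Matrix (Fin 7) (Fin 7) A :=
  let r : K := 1 + q ^ 2
  !![κ₁ • 1, 0, 0, 0, 0, 0, 0;
     0, κ₂ • 1, 0, 0, 0, 0, 0;
     0, 0, μ • am ^ 2, α • (k * am), (-((r * μ)⁻¹ * α ^ 2)) • k ^ 2, 0, 0;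
     0, 0, (-(r * α⁻¹ * μ)) • (am * k), am * ap - k ^ 2, (-((q * μ)⁻¹ * α)) • (k * ap), 0, 0;
     0, 0, (-(r * (q * α⁻¹) ^ 2 * μ)) • k ^ 2, (r * α⁻¹) • (k * ap), μ⁻¹ • ap ^ 2, 0, 0;
     0, 0, 0, 0, 0, κ₂⁻¹ • 1, 0;
     0, 0, 0, 0, 0, 0, κ₁⁻¹ • 1]

/-- The labels of the diagonal blocks of `oscMatrix₃`. -/
def blockLabel₃ : Fin 7 → ℕ := ![0, 1, 2, 2, 2, 3, 4]

theorem oscMatrix₃_apply_eq_zero (q α μ κ₁ κ₂ : K) (ap am k : A) (i j : Fin 7)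
    (h : blockLabel₃ i ≠ blockLabel₃ j) : oscMatrix₃ q α μ κ₁ κ₂ ap am k i j = 0 := by
  revert i j
  apply forall_fin_seven <;> apply forall_fin_seven <;>
    first | exact fun h => (h rfl).elim | exact fun _ => rfl

theorem blockLabel₃_add_rev (i : Fin 7) : blockLabel₃ i + blockLabel₃ i.rev = 4 := by
  revert i
  decide

set_option maxHeartbeats 4000000 in
theorem rttAt_oscMatrix₃ {q α μ κ₁ κ₂ : K} (hq : q ≠ 0) (hα : α ≠ 0) (hμ : μ ≠ 0)
    (hκ₁ : κ₁ ≠ 0) (hκ₂ : κ₂ ≠ 0) (hr : 1 + q ^ 2 ≠ 0)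
    {ap am k : A} (ho : IsOscillator (q) ap am k) (i j k' l : Fin 7) :
    RTTAt q (oscMatrix₃ q α μ κ₁ κ₂ ap am k) i j k' l := by
  obtain ⟨h1, h2, h3, h4⟩ := ho
  -- The block entries are quadratic in the oscillators, so words of length four occur. With words
  -- associated to the right, each relation is also needed with an arbitrary tail `x`, so that it
  -- applies inside a word.
  have h1' := fun x => congrArg (· * x) h1
  have h2' := fun x => congrArg (· * x) h2
  have h3' := fun x => congrArg (· * x) h3
  have h4' := fun x => congrArg (· * x) h4
  simp only [mul_assoc, sub_mul, one_mul, smul_mul_assoc] at h1' h2' h3' h4'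
  generalize hT : oscMatrix₃ q α μ κ₁ κ₂ ap am k = T
  have hz : ∀ i j, blockLabel₃ i ≠ blockLabel₃ j → T i j = 0 :=
    hT ▸ oscMatrix₃_apply_eq_zero q α μ κ₁ κ₂ ap am k
  revert i j k' l
  apply forall_fin_seven <;> apply forall_fin_seven <;> apply forall_fin_seven <;>
    apply forall_fin_seven <;>
    try exact rttAt_of_vanishes q blockLabel₃_add_rev hz rfl
  all_goals
    subst hT
    simp only [RTTAt, rDiag, rho_three_zero, rho_three_one, rho_three_two, rho_three_three,
      rho_three_four, rho_three_five, rho_three_six, Fin.sum_univ_seven, Fin.isValue, Fin.reduceEq,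
      Fin.reduceLT, Fin.reduceRev, Int.reduceSub, Int.reduceNeg, if_true, if_false, zero_smul]
    try simp only [oscMatrix₃, Matrix.of_apply, Matrix.cons_val]
    try simp only [mul_zero, zero_mul, smul_zero, add_zero, zero_add, sub_zero, smul_mul_assoc,
      mul_smul_comm, smul_smul, one_mul, mul_one, smul_sub, h1, h2, h3, h4,
      h1', h2', h3', h4', mul_assoc, mul_sub, sub_mul, pow_two]
  all_goals match_scalars <;> field_simp <;> ring

-- The block on `{2, 3, 4}` is stable under reversal, so it is paired with itself: up to reflection
-- and powers of `q` it is its own inverse.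
set_option maxHeartbeats 4000000 in
theorem orth_oscMatrix₃ {q α μ κ₁ κ₂ : K} (hq : q ≠ 0) (hα : α ≠ 0) (hμ : μ ≠ 0)
    (hκ₁ : κ₁ ≠ 0) (hκ₂ : κ₂ ≠ 0) (hr : 1 + q ^ 2 ≠ 0)
    {ap am k : A} (ho : IsOscillator (q) ap am k) (i m : Fin 7) :
    ∑ j : Fin 7, q ^ (rho 3 m - rho 3 j) •
        (oscMatrix₃ q α μ κ₁ κ₂ ap am k i j * oscMatrix₃ q α μ κ₁ κ₂ ap am k m.rev j.rev) =
        (if i = m then 1 else 0) ∧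
      ∑ j : Fin 7, q ^ (-rho 3 i - rho 3 j) •
        (oscMatrix₃ q α μ κ₁ κ₂ ap am k j i.rev * oscMatrix₃ q α μ κ₁ κ₂ ap am k j.rev m) =
        (if i = m then 1 else 0) := by
  obtain ⟨h1, h2, h3, h4⟩ := ho
  have h1' := fun x => congrArg (· * x) h1
  have h2' := fun x => congrArg (· * x) h2
  have h3' := fun x => congrArg (· * x) h3
  have h4' := fun x => congrArg (· * x) h4
  simp only [mul_assoc, sub_mul, one_mul, smul_mul_assoc] at h1' h2' h3' h4'
  generalize hT : oscMatrix₃ q α μ κ₁ κ₂ ap am k = T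
  revert i m
  apply forall_fin_seven <;> apply forall_fin_seven <;> constructor
  all_goals
    subst hT
    simp only [rho_three_zero, rho_three_one, rho_three_two, rho_three_three,
      rho_three_four, rho_three_five, rho_three_six, Fin.sum_univ_seven, Fin.isValue, Fin.reduceEq,
      Fin.reduceLT, Fin.reduceRev, Int.reduceSub, Int.reduceNeg, if_true, if_false, zero_smul]
    try simp only [oscMatrix₃, Matrix.of_apply, Matrix.cons_val]
    try simp only [mul_zero, zero_mul, smul_zero, add_zero, zero_add, sub_zero, smul_mul_assoc,
      mul_smul_comm, smul_smul, one_mul, mul_one, smul_sub, h1, h2, h3, h4,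
      h1', h2', h3', h4', mul_assoc, mul_sub, sub_mul, pow_two]
  all_goals match_scalars <;> field_simp <;> ring

/-! ### Irreducibility on the Fock space -/

/-- A representation on the Fock space is irreducible if it contains a lowering operator and a
raising operator, both with nonvanishing matrix elements. -/
theorem isIrreducibleRep_of_ladder (ρ : A →ₐ[K] Module.End K (Fock K)) (x y : A) (c u : ℕ → K)
    (hc : ∀ m, c m ≠ 0) (hu : ∀ m, u m ≠ 0) (hx₀ : ρ x (ket K 0) = 0)
    (hx : ∀ m, ρ x (ket K (m + 1)) = c m • ket K m) (hy : ∀ m, ρ y (ket K m) = u m • ket K (m + 1)) :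
    IsIrreducibleRep ρ := by
  have hcoeff : ∀ (w : Fock K) (m : ℕ), ρ x w m = c m * w (m + 1) := by
    intro w m
    induction w using Finsupp.induction_linear with
    | zero => simp
    | add v w hv hw => simp [hv, hw, mul_add]
    | single n a =>
      have hs : Finsupp.single n a = a • ket K n := by simp [ket]
      rw [hs, map_smul]
      cases n with
      | zero =>
        rw [hx₀]
        simp [ket]
      | succ n =>
        rw [hx]
        by_cases hnm : n = m
        · simp [ket, hnm, mul_comm]
        · simp [ket, hnm]
  refine ⟨inferInstance, fun W hW => or_iff_not_imp_left.2 fun hbot => ?_⟩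
  obtain ⟨w, hwW, hw⟩ := W.ne_bot_iff.1 hbot
  -- Induction on a bound `n` for the degree of `v`. If the coefficient in degree `n + 1` is
  -- nonzero, lowering gives a vector of degree exactly `n`, nonzero because `c n ≠ 0`.
  have hvac : ∀ n, ∀ v ∈ W, v ≠ 0 → (∀ m, n < m → v m = 0) → ket K 0 ∈ W := by
    intro n
    induction n with
    | zero =>
      intro v hv hv0 hsupp
      have hv' : v = v 0 • ket K 0 := by
        ext m
        cases m with
        | zero => simp [ket]
        | succ m => simp [ket, hsupp (m + 1) m.succ_pos]
      have h0 : v 0 ≠ 0 := fun h => hv0 (by rw [hv', h, zero_smul])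
      exact (W.smul_mem_iff h0).1 (hv' ▸ hv)
    | succ n ih =>
      intro v hv hv0 hsupp
      by_cases hn : v (n + 1) = 0
      · refine ih v hv hv0 fun m hm => ?_
        rcases Nat.eq_or_lt_of_le (Nat.succ_le_of_lt hm) with h | h
        · rw [← h, hn]
        · exact hsupp m h
      · refine ih (ρ x v) (hW x v hv) (fun h => ?_) fun m hm => ?_
        · have := hcoeff v n
          rw [h] at this
          exact mul_ne_zero (hc n) hn this.symm
        · rw [hcoeff, hsupp (m + 1) (Nat.succ_lt_succ hm), mul_zero]
  have hket : ∀ n, ket K n ∈ W := by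
    intro n
    induction n with
    | zero =>
      refine hvac (w.support.sup id) w hwW hw fun m hm => ?_
      by_contra h
      exact hm.not_ge (Finset.le_sup (f := id) (Finsupp.mem_support_iff.2 h))
    | succ n ih => exact (W.smul_mem_iff (hu n)).1 (hy n ▸ hW y _ ih)
  refine eq_top_iff.2 fun v _ => ?_
  induction v using Finsupp.induction_linear with
  | zero => exact W.zero_mem
  | add v w hv hw => exact W.add_mem (hv trivial) (hw trivial)
  | single n a =>
    have hs : Finsupp.single n a = a • ket K n := by simp [ket]
    exact hs ▸ W.smul_mem a (hket n)

theorem fock_aPlus_ket (q : K) (hq : q ≠ 0) (m : ℕ) :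
    fock q hq (aPlus q) (ket K m) = ket K (m + 1) := by
  simp [fock, aPlus, fockGen, ket]

theorem fock_aMinus_ket (q : K) (hq : q ≠ 0) (m : ℕ) :
    fock q hq (aMinus q) (ket K m) = (1 - q ^ (2 * m)) • ket K (m - 1) := by
  simp [fock, aMinus, fockGen, ket]

theorem fock_kk_ket (q : K) (hq : q ≠ 0) (m : ℕ) :
    fock q hq (kk q) (ket K m) = q ^ m • ket K m := by
  simp [fock, kk, fockGen, ket]

/-- A representation of `A` through `Osc_q` is irreducible if nonzero multiples of `a⁻` and `a⁺` are
in the image. -/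
theorem isIrreducibleRep_fock_comp {q : K} (hq : q ≠ 0) (hroot : ∀ m, 0 < m → q ^ m ≠ 1)
    (φ : A →ₐ[K] Osc q) {x y : A} {a b : K} (ha : a ≠ 0) (hb : b ≠ 0)
    (hx : φ x = a • aMinus q) (hy : φ y = b • aPlus q) :
    IsIrreducibleRep ((fock q hq).comp φ) := by
  refine isIrreducibleRep_of_ladder _ x y (fun m => a * (1 - q ^ (2 * (m + 1)))) (fun _ => b)
    (fun m => mul_ne_zero ha (sub_ne_zero.2 (hroot _ (by lia)).symm)) (fun _ => hb) ?_
    (fun m => ?_) (fun m => ?_)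
  -- At `m = 0` the truncated index `0 - 1` is `0`, but the coefficient `1 - q ^ 0` vanishes.
  · simp [hx, fock_aMinus_ket]
  · simp [hx, fock_aMinus_ket, smul_smul]
  · simp [hy, fock_aPlus_ket]

/-- A representation of `A` through `Osc_q` is irreducible if nonzero multiples of `k a⁻` and `k a⁺`
are in the image. -/
theorem isIrreducibleRep_fock_comp_of_kk_mul {q : K} (hq : q ≠ 0) (hroot : ∀ m, 0 < m → q ^ m ≠ 1)
    (φ : A →ₐ[K] Osc q) {x y : A} {a b : K} (ha : a ≠ 0) (hb : b ≠ 0)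
    (hx : φ x = a • (kk q * aMinus q)) (hy : φ y = b • (kk q * aPlus q)) :
    IsIrreducibleRep ((fock q hq).comp φ) := by
  -- `k` acts after the shift, hence contributes `q ^ m` when lowering `|m+1⟩` and `q ^ (m + 1)`
  -- when raising `|m⟩`.
  refine isIrreducibleRep_of_ladder _ x y (fun m => a * ((1 - q ^ (2 * (m + 1))) * q ^ m))
    (fun m => b * q ^ (m + 1))
    (fun m => mul_ne_zero ha (mul_ne_zero (sub_ne_zero.2 (hroot _ (by lia)).symm) (pow_ne_zero _ hq)))
    (fun m => mul_ne_zero hb (pow_ne_zero _ hq)) ?_ (fun m => ?_) (fun m => ?_)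
  · simp [hx, fock_aMinus_ket]
  · simp [hx, fock_aMinus_ket, fock_kk_ket, smul_smul]
  · simp [hy, fock_aPlus_ket, fock_kk_ket, smul_smul]

/-- Both sides are polynomials, of degrees `m` and `0`. This is the only property of the
indeterminate used beyond being nonzero. -/
theorem ratFunc_X_pow_ne_one {F : Type*} [Field F] {m : ℕ} (hm : 0 < m) :
    (RatFunc.X : RatFunc F) ^ m ≠ 1 := by
  intro h
  rw [← RatFunc.algebraMap_X, ← map_pow, ← map_one (algebraMap (Polynomial F) (RatFunc F))] at h
  have := congrArg Polynomial.natDegree (RatFunc.algebraMap_injective F h)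
  simp at this
  lia

end QFun

/-! ### The proposition -/

theorem proposition1 (q : RatFunc ℂ) (hq : q = RatFunc.X) :
    (∀ α β μ ν κ σ : RatFunc ℂ, α ≠ 0 → β ≠ 0 → μ ≠ 0 → ν ≠ 0 → κ ≠ 0 →
      α * β = -q ^ 2 * μ * ν → (σ = 1 ∨ σ = -1) →
      ∃ φ : QFun.AqB q 3 →ₐ[RatFunc ℂ] QFun.Osc (q ^ 2),
        (∀ i j, φ (QFun.t q 3 i j) = QFun.piMat₁ q α β μ ν κ σ i j) ∧
        (∀ ψ : QFun.AqB q 3 →ₐ[RatFunc ℂ] QFun.Osc (q ^ 2),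
          (∀ i j, ψ (QFun.t q 3 i j) = QFun.piMat₁ q α β μ ν κ σ i j) → ψ = φ) ∧
        QFun.IsIrreducibleRep ((QFun.fock (q ^ 2) (pow_ne_zero 2 (hq ▸ RatFunc.X_ne_zero))).comp φ)) ∧
    (∀ α β μ ν κ σ : RatFunc ℂ, α ≠ 0 → β ≠ 0 → μ ≠ 0 → ν ≠ 0 → κ ≠ 0 →
      α * β = -q ^ 2 * μ * ν → (σ = 1 ∨ σ = -1) →
      ∃ φ : QFun.AqB q 3 →ₐ[RatFunc ℂ] QFun.Osc (q ^ 2),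
        (∀ i j, φ (QFun.t q 3 i j) = QFun.piMat₂ q α β μ ν κ σ i j) ∧
        (∀ ψ : QFun.AqB q 3 →ₐ[RatFunc ℂ] QFun.Osc (q ^ 2),
          (∀ i j, ψ (QFun.t q 3 i j) = QFun.piMat₂ q α β μ ν κ σ i j) → ψ = φ) ∧
        QFun.IsIrreducibleRep ((QFun.fock (q ^ 2) (pow_ne_zero 2 (hq ▸ RatFunc.X_ne_zero))).comp φ)) ∧
    (∀ α μ κ₁ κ₂ : RatFunc ℂ, α ≠ 0 → μ ≠ 0 → κ₁ ≠ 0 → κ₂ ≠ 0 →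
      ∃ φ : QFun.AqB q 3 →ₐ[RatFunc ℂ] QFun.Osc q,
        (∀ i j, φ (QFun.t q 3 i j) = QFun.piMat₃ q α μ κ₁ κ₂ i j) ∧
        (∀ ψ : QFun.AqB q 3 →ₐ[RatFunc ℂ] QFun.Osc q,
          (∀ i j, ψ (QFun.t q 3 i j) = QFun.piMat₃ q α μ κ₁ κ₂ i j) → ψ = φ) ∧
        QFun.IsIrreducibleRep ((QFun.fock q (hq ▸ RatFunc.X_ne_zero)).comp φ)) := by
  have hq0 : q ≠ 0 := hq ▸ RatFunc.X_ne_zero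
  have hroot : ∀ m, 0 < m → q ^ m ≠ 1 := fun m hm => hq ▸ QFun.ratFunc_X_pow_ne_one hm
  have hroot' : ∀ m, 0 < m → (q ^ 2) ^ m ≠ 1 := fun m hm => by
    rw [← pow_mul]
    exact hroot _ (by lia)
  -- `(q ^ 2 - 1) * (1 + q ^ 2) = q ^ 4 - 1`, so a zero would make `q` a root of unity.
  have hr : 1 + q ^ 2 ≠ 0 := fun h => hroot 4 (by norm_num) (by linear_combination (q ^ 2 - 1) * h)
  have hsq : ∀ σ : RatFunc ℂ, σ = 1 ∨ σ = -1 → σ * σ = 1 := by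
    rintro σ (rfl | rfl) <;> norm_num
  refine ⟨fun α β μ ν κ σ hα hβ hμ hν hκ h hσ => ?_, fun α β μ ν κ σ hα hβ hμ hν hκ h hσ => ?_,
    fun α μ κ₁ κ₂ hα hμ hκ₁ hκ₂ => ?_⟩
  · have ho := QFun.isOscillator_osc (q ^ 2)
    -- `piMat₁` is by definition `oscMatrix₁` at the generators of `Osc (q ^ 2)`, so the abstract
    -- verification applies directly.
    obtain ⟨φ, hφ, hu⟩ := QFun.existsUnique_algHom_of_relations hq0 (QFun.piMat₁ q α β μ ν κ σ)
      (QFun.rttAt_oscMatrix₁ hq0 hα hμ hν hκ h (hsq σ hσ) ho)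
      (fun i m => (QFun.orth_oscMatrix₁ hq0 hα hμ hν hκ h (hsq σ hσ) ho i m).1)
      (fun i m => (QFun.orth_oscMatrix₁ hq0 hα hμ hν hκ h (hsq σ hσ) ho i m).2)
    exact ⟨φ, hφ, hu, QFun.isIrreducibleRep_fock_comp _ hroot' φ hμ hν (hφ 0 0) (hφ 1 1)⟩
  · have ho := QFun.isOscillator_osc (q ^ 2)
    obtain ⟨φ, hφ, hu⟩ := QFun.existsUnique_algHom_of_relations hq0 (QFun.piMat₂ q α β μ ν κ σ)
      (QFun.rttAt_oscMatrix₂ hq0 hα hμ hν hκ h (hsq σ hσ) ho)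
      (fun i m => (QFun.orth_oscMatrix₂ hq0 hα hμ hν hκ h (hsq σ hσ) ho i m).1)
      (fun i m => (QFun.orth_oscMatrix₂ hq0 hα hμ hν hκ h (hsq σ hσ) ho i m).2)
    exact ⟨φ, hφ, hu, QFun.isIrreducibleRep_fock_comp _ hroot' φ hμ hν (hφ 1 1) (hφ 2 2)⟩
  · have ho := QFun.isOscillator_osc q
    obtain ⟨φ, hφ, hu⟩ := QFun.existsUnique_algHom_of_relations hq0 (QFun.piMat₃ q α μ κ₁ κ₂)
      (QFun.rttAt_oscMatrix₃ hq0 hα hμ hκ₁ hκ₂ hr ho)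
      (fun i m => (QFun.orth_oscMatrix₃ hq0 hα hμ hκ₁ hκ₂ hr ho i m).1)
      (fun i m => (QFun.orth_oscMatrix₃ hq0 hα hμ hκ₁ hκ₂ hr ho i m).2)
    -- The corner entries `(a⁻)²` and `(a⁺)²` preserve the parity of the degree, so the ladder
    -- operators come from the middle column of the block, with coefficients `α` and `r * α⁻¹`.
    exact ⟨φ, hφ, hu, QFun.isIrreducibleRep_fock_comp_of_kk_mul _ hroot φ hα
      (mul_ne_zero hr (inv_ne_zero hα)) (hφ 2 3) (hφ 4 3)⟩
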